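/- Let $m\ge n$ be natural numbers, $\eta>0$, and $\mathcal T_\eta(\sigma)=(\sigma-\eta)_+=\max(\sigma-\eta,0)$ with derivative $\mathcal T_\eta'$. A full singular value decomposition (SVD) of $X\in\mathbf R^{m\times n}$ is $X=U\Sigma V^T$ with $U\in\mathbf R^{m\times m}$, $V\in\mathbf R^{n\times n}$ orthogonal and $\Sigma\in\mathbf R^{m\times n}$ zero off the diagonal, with diagonal entries $\sigma_1,\dots,\sigma_n\ge 0$ (the singular values of $X$). Let $F(X)=U\,\mathcal T_\eta(\Sigma)\,V^T$, where $\mathcal T_\eta$ is applied to every entry of $\Sigma$ (singular value thresholding). A matrix is simple if it has no repeated singular values. Adjoints are taken with respect to the Frobenius inner product $\langle A\mid B\rangle=\operatorname{Tr}(A^TB)$. Let $\mathcal S_\eta\subset\mathbf R^{m\times n}$ be the set of matrices with no singular value equal to $\eta$, and fix $Z\in\mathbf R^{m\times n}$. Then $F(X)$ does not depend on the choice of the SVD; $F$ is differentiable at every simple full-rank $X\in\mathcal S_\eta$, so that $X\mapsto (DF(X))^*Z$ is defined there; and there is a map $G:\mathbf R^{m\times n}\to\mathbf R^{m\times n}$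 such that 1. $G$ is continuous on $\mathcal S_\eta$; 2. $G(X)=(DF(X))^*Z$ at every $X$ at which $F$ is differentiable; 3. for every $X\in\mathcal S_\eta$ and every full SVD $X=U\Sigma V^T$, with $\zeta=U^TZV$, one has $G(X)=U\Gamma V^T$, where $$\Gamma_{ij}=\begin{cases}\mathcal T_\eta'(\sigma_i)\,\zeta_{ii}&\text{if } i=j,\\ R(\sigma_j)\,\zeta_{ij}&\text{if } i>n,\\ Q(\sigma_i,\sigma_j)\,\zeta_{ij}+T(\sigma_i,\sigma_j)\,\zeta_{ji}&\text{otherwise,}\end{cases}$$ $$R(\sigma)=\begin{cases}\mathcal T_\eta(\sigma)/\sigma&\text{if }\sigma>0,\\ \mathcal T_\eta'(0)&\text{if }\sigma=0,\end{cases}$$ $$Q(\sigma_i,\sigma_j)=\begin{cases}\frac12\mathcal T_\eta'(\sigma_i)+\frac12\frac{\mathcal T_\eta(\sigma_i)}{\sigma_i}&\text{if }\sigma_i=\sigma_j>0,\\ \mathcal T_\eta'(0)&\text{if }\sigma_i=\sigma_j=0,\\ \frac{\sigma_i\mathcal T_\eta(\sigma_i)-\sigma_j\mathcal T_\eta(\sigma_j)}{\sigma_i^2-\sigma_j^2}&\text{otherwise,}\end{cases}$$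 $$T(\sigma_i,\sigma_j)=\begin{cases}\frac12\mathcal T_\eta'(\sigma_i)-\frac12\frac{\mathcal T_\eta(\sigma_i)}{\sigma_i}&\text{if }\sigma_i=\sigma_j>0,\\ 0&\text{if }\sigma_i=\sigma_j=0,\\ \frac{\sigma_j\mathcal T_\eta(\sigma_i)-\sigma_i\mathcal T_\eta(\sigma_j)}{\sigma_i^2-\sigma_j^2}&\text{otherwise;}\end{cases}$$ 4. on $\mathcal S_\eta$, $G$ is the only continuous extension: if $H$ is continuous on $\mathcal S_\eta$ and $H(X)=(DF(X))^*Z$ for all simple full-rank $X\in\mathcal S_\eta$, then $H=G$ on $\mathcal S_\eta$. -/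

import Mathlib

noncomputable section

namespace SVT

/-- Real `m × n` matrices, with Mathlib's (product) topology. -/
abbrev Mat (m n : ℕ) := Matrix (Fin m) (Fin n) ℝ

/-- Soft thresholding `𝒯_η(s) = (s - η)₊`. -/
def softThreshold (η s : ℝ) : ℝ := max (s - η) 0

/-- The rectangular `m × n` matrix with diagonal `s` and zeros elsewhere. -/
def rectDiag (m : ℕ) {n : ℕ} (s : Fin n → ℝ) : Mat m n :=
  Matrix.of fun i j => if (i : ℕ) = (j : ℕ) then s j else 0

/-- `X = U Σ Vᵀ` is a full singular value decomposition (for `n ≤ m`); the singular values are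
nonnegative and may be listed in any order. -/
structure IsSVD {m n : ℕ} (X : Mat m n) (U : Mat m m) (s : Fin n → ℝ) (V : Mat n n) : Prop where
  left_orthogonal : U ∈ Matrix.orthogonalGroup (Fin m) ℝ
  right_orthogonal : V ∈ Matrix.orthogonalGroup (Fin n) ℝ
  nonneg : ∀ j, 0 ≤ s j
  eq_mul : X = U * rectDiag m s * V.transpose

/-- The `n` singular values of an `m × n` matrix (`n ≤ m`), in decreasing order, with multiplicity:
square roots of the eigenvalues of `Xᵀ X`. -/
def singVal {m n : ℕ} (X : Mat m n) (j : Fin n) : ℝ :=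
  (Matrix.toEuclideanLin X).singularValues j

/-- A matrix is simple if it has no repeated singular values. -/
def IsSimple {m n : ℕ} (X : Mat m n) : Prop := Function.Injective (singVal X)

/-- Full rank, for `m × n` matrices with `n ≤ m`. -/
def IsFullRank {m n : ℕ} (X : Mat m n) : Prop := X.rank = n

/-- The matrices with no singular value equal to `η`. -/
def noSingValEq (m n : ℕ) (η : ℝ) : Set (Mat m n) := {X | ∀ j, singVal X j ≠ η}

/-- Every matrix with `n ≤ m` has a full singular value decomposition. -/
theorem exists_isSVD {m n : ℕ} (hmn : n ≤ m) (X : Mat m n) :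
    ∃ (U : Mat m m) (s : Fin n → ℝ) (V : Mat n n), IsSVD X U s V := by
  have hA : (X.transpose * X).IsHermitian := by
    simpa using Matrix.isHermitian_conjTranspose_mul_self X
  have hpsd : (X.transpose * X).PosSemidef := by
    simpa using Matrix.posSemidef_conjTranspose_mul_self X
  set V : Mat n n := (hA.eigenvectorUnitary : Matrix (Fin n) (Fin n) ℝ) with hV
  have hVm : V ∈ Matrix.orthogonalGroup (Fin n) ℝ := hA.eigenvectorUnitary.2
  set l := hA.eigenvalues with hl
  have hl0 : ∀ j, 0 ≤ l j := fun j => hpsd.eigenvalues_nonneg j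
  have hVV : V * V.transpose = 1 := by
    simpa using (Matrix.mem_orthogonalGroup_iff (Fin n) ℝ).1 hVm
  have hVV' : V.transpose * V = 1 := by
    simpa using (Matrix.mem_orthogonalGroup_iff' (Fin n) ℝ).1 hVm
  set Y : Mat m n := X * V with hY
  have hYY : Y.transpose * Y = Matrix.diagonal l := by
    have h := hA.spectral_theorem
    rw [Unitary.conjStarAlgAut_apply] at h
    have h2 : X.transpose * X = V * Matrix.diagonal l * V.transpose := by
      simpa [Matrix.star_eq_conjTranspose, Function.comp_def, hV, hl] using h
    calc Y.transpose * Y = V.transpose * (X.transpose * X) * V := by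
          rw [hY, Matrix.transpose_mul]; simp only [Matrix.mul_assoc]
      _ = (V.transpose * V) * Matrix.diagonal l * (V.transpose * V) := by
          rw [h2]; simp only [Matrix.mul_assoc]
      _ = _ := by rw [hVV']; simp
  have hsum : ∀ j k, ∑ i, Y i j * Y i k = if j = k then l j else 0 := by
    intro j k
    have := congrFun (congrFun hYY j) k
    simpa [Matrix.mul_apply, Matrix.diagonal_apply] using this
  let v : Fin m → EuclideanSpace ℝ (Fin m) := fun i =>
    if h : (i : ℕ) < n then WithLp.toLp 2 (fun k => Y k ⟨i, h⟩ / √(l ⟨i, h⟩)) else 0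
  let S : Set (Fin m) := {i | ∃ h : (i : ℕ) < n, l ⟨i, h⟩ ≠ 0}
  have hv : Orthonormal ℝ (S.domRestrict v) := by
    rw [orthonormal_iff_ite]
    rintro ⟨i, hi, hli⟩ ⟨j, hj, hlj⟩
    have hpi : 0 < l ⟨i, hi⟩ := lt_of_le_of_ne (hl0 _) (Ne.symm hli)
    have hpj : 0 < l ⟨j, hj⟩ := lt_of_le_of_ne (hl0 _) (Ne.symm hlj)
    have e : inner ℝ (v i) (v j)
        = (∑ k, Y k ⟨i, hi⟩ * Y k ⟨j, hj⟩) / (√(l ⟨i, hi⟩) * √(l ⟨j, hj⟩)) := by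
      simp only [v, hi, hj, dif_pos, PiLp.inner_apply, Finset.sum_div]
      refine Finset.sum_congr rfl fun k _ => ?_
      simp only [RCLike.inner_apply, conj_trivial]
      rw [div_mul_div_comm, mul_comm, mul_comm (√(l ⟨j, hj⟩))]
    change inner ℝ (v i) (v j) = _
    rw [e, hsum]
    by_cases hij : i = j
    · subst hij
      simp [hpi.ne', Real.mul_self_sqrt hpi.le]
    · have : (i : ℕ) ≠ j := fun h => hij (Fin.ext h)
      simp [hij, this]
  obtain ⟨b, hb⟩ := hv.exists_orthonormalBasis_extension_of_card_eq (by simp)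
  refine ⟨Matrix.of fun k i => b i k, fun j => √(l j), V, ?_, hVm, fun j => Real.sqrt_nonneg _, ?_⟩
  · rw [Matrix.mem_orthogonalGroup_iff']
    ext i j
    have := orthonormal_iff_ite.1 b.orthonormal i j
    rw [PiLp.inner_apply] at this
    simpa [Matrix.mul_apply, Matrix.one_apply, mul_comm] using this
  · have hU : (Matrix.of fun k i => b i k) * rectDiag m (fun j => √(l j)) = Y := by
      ext k j
      have e : ((Matrix.of fun k i => b i k) * rectDiag m (fun j => √(l j))) k j
          = b (Fin.castLE hmn j) k * √(l j) := by
        rw [Matrix.mul_apply, Finset.sum_eq_single (Fin.castLE hmn j)]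
        · simp [rectDiag]
        · intro i _ hi
          have : (i : ℕ) ≠ j := fun h => hi (Fin.ext h)
          simp [rectDiag, this]
        · simp
      rw [e]
      by_cases hj : l j = 0
      · have h0 := hsum j j
        simp only [if_true, hj] at h0
        have := (Finset.sum_eq_zero_iff_of_nonneg (fun i _ => mul_self_nonneg (Y i j))).1 h0 k
          (Finset.mem_univ k)
        simp [hj, mul_self_eq_zero.1 this]
      · have hpj : 0 < l j := lt_of_le_of_ne (hl0 _) (Ne.symm hj)
        rw [hb (Fin.castLE hmn j) ⟨j.2, hj⟩]
        simp only [v, Fin.val_castLE, Fin.is_lt, dif_pos, Fin.eta]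
        exact div_mul_cancel₀ _ (Real.sqrt_pos.2 hpj).ne'
    rw [hU, hY, Matrix.mul_assoc, hVV, Matrix.mul_one]

/-- Singular value thresholding: `F(X) = U 𝒯_η(Σ) Vᵀ` for a full singular value decomposition
`X = U Σ Vᵀ`, where `𝒯_η` is applied to all entries of `Σ`. (A decomposition is chosen here; the
value does not depend on it, which is part of the theorem.) -/
def svt {m n : ℕ} (hmn : n ≤ m) (η : ℝ) (X : Mat m n) : Mat m n :=
  let U := (exists_isSVD hmn X).choose
  let s := (exists_isSVD hmn X).choose_spec.choose
  let V := (exists_isSVD hmn X).choose_spec.choose_spec.choose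
  U * (rectDiag m s).map (softThreshold η) * V.transpose

/-- The Frobenius inner product `⟨A | B⟩ = Tr(Aᵀ B)`. -/
def frobInner {m n : ℕ} (A B : Mat m n) : ℝ := (A.transpose * B).trace

/-- The adjoint `L^* Z` of a linear operator on matrices for the Frobenius inner product,
see `frobInner_frobAdjoint`. -/
def frobAdjoint {m n : ℕ} (L : Mat m n →L[ℝ] Mat m n) (Z : Mat m n) : Mat m n :=
  Matrix.of fun i j => frobInner Z (L (Matrix.single i j 1))

theorem frobInner_frobAdjoint {m n : ℕ} (L : Mat m n →L[ℝ] Mat m n) (Z D : Mat m n) :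
    frobInner (frobAdjoint L Z) D = frobInner Z (L D) := by
  have hsum : ∀ A B : Mat m n, frobInner A B = ∑ i, ∑ j, A i j * B i j := by
    intro A B
    simp only [frobInner, Matrix.trace, Matrix.diag_apply, Matrix.mul_apply,
      Matrix.transpose_apply]
    exact Finset.sum_comm
  have hD : D = ∑ i, ∑ j, D i j • Matrix.single i j (1 : ℝ) := by
    conv_lhs => rw [Matrix.matrix_eq_sum_single D]
    simp [Matrix.smul_single]
  let φ : Mat m n →ₗ[ℝ] ℝ :=
    { toFun := fun B => frobInner Z B
      map_add' := fun B C => by simp [frobInner, Matrix.mul_add]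
      map_smul' := fun c B => by simp [frobInner] }
  change _ = φ (L D)
  conv_rhs => rw [hD]
  rw [hsum]
  simp only [map_sum, map_smul, smul_eq_mul]
  refine Finset.sum_congr rfl fun i _ => Finset.sum_congr rfl fun j _ => ?_
  rw [mul_comm]
  rfl

/-- The vector-Jacobian product `(DF(X))^* Z` of singular value thresholding `F`
(meaningful where `F` is differentiable at `X`). -/
def adjointJacobian {m n : ℕ} (hmn : n ≤ m) (η : ℝ) (Z X : Mat m n) : Mat m n :=
  frobAdjoint (fderiv ℝ (svt hmn η) X) Z

/-- `R(a)`, for `a ≥ 0`. -/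
def coeffR (η a : ℝ) : ℝ :=
  if 0 < a then softThreshold η a / a else deriv (softThreshold η) a

/-- `Q(a, b)`, for `a, b ≥ 0`. -/
def coeffQ (η a b : ℝ) : ℝ :=
  if a = b ∧ 0 < b then
    1 / 2 * deriv (softThreshold η) a + 1 / 2 * (softThreshold η a / a)
  else if a = b ∧ b = 0 then deriv (softThreshold η) 0
  else (a * softThreshold η a - b * softThreshold η b) / (a ^ 2 - b ^ 2)

/-- `T(a, b)`, for `a, b ≥ 0`. -/
def coeffT (η a b : ℝ) : ℝ :=
  if a = b ∧ 0 < b then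
    1 / 2 * deriv (softThreshold η) a - 1 / 2 * (softThreshold η a / a)
  else if a = b ∧ b = 0 then 0
  else (b * softThreshold η a - a * softThreshold η b) / (a ^ 2 - b ^ 2)

/-- The matrix `Γ`. Indices start at `0`, so the block "`i > n`" consists of the rows `i` with
`n ≤ i`; the entry `ζ_{ji}` is `ζ (Fin.castLE hmn j) ⟨i, _⟩`. -/
def Gam {m n : ℕ} (hmn : n ≤ m) (η : ℝ) (s : Fin n → ℝ) (ζ : Mat m n) : Mat m n :=
  Matrix.of fun i j =>
    if hi : (i : ℕ) < n then
      if (i : ℕ) = (j : ℕ) then deriv (softThreshold η) (s ⟨i, hi⟩) * ζ i j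
      else coeffQ η (s ⟨i, hi⟩) (s j) * ζ i j
        + coeffT η (s ⟨i, hi⟩) (s j) * ζ (Fin.castLE hmn j) ⟨i, hi⟩
    else coeffR η (s j) * ζ i j

end SVT

end

noncomputable section

namespace SVT

open Matrix Polynomial

variable {m n : ℕ}

/-! Near a matrix without singular value `η`, thresholding acts on singular values as `σ ↦ σ g(σ²)`
with `g` of class `C¹`: the kink of the threshold falls into a gap that persists on a neighbourhood
(`exists_isOpen_singular_gap`, `exists_contDiff_softThreshold`). For a polynomial `p` in place of
`g` the map is `X ↦ X p(Xᵀ X)`, which involves no choice of decomposition. Its derivative, in bases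
of singular vectors, is given by the divided differences of `p` at the squared singular values
(`IsSVD.fderiv_mul_aeval_gram`), so repeated or zero singular values need no separate treatment.

Polynomials approximate `g` in `C¹` on a bounded interval, hence also in all divided differences.
The derivatives therefore converge uniformly, the limit is `C¹`, and the same formula holds for `g`
(`contDiffOn_spectral`).

Divided differences are symmetric, so the derivative is self-adjoint (`frobInner_derivCore`) and its
adjoint at `Z` is the derivative in the direction `Z`. Rewriting divided differences of `g` in terms
of the threshold gives `Γ` (`Gam_eq_derivCore`). Thus `F` is `C¹` on the whole set, and `G` is the
adjoint Jacobian itself. Uniqueness follows from density of the simple full-rank matrices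
(`mem_closure_simple`). -/

/-! ### Rectangular diagonal matrices. -/

theorem rectDiag_transpose_mul_self (hmn : n ≤ m) (s : Fin n → ℝ) :
    (rectDiag m s)ᵀ * rectDiag m s = diagonal fun j => s j ^ 2 := by
  ext j k
  rw [Matrix.mul_apply, Finset.sum_eq_single (Fin.castLE hmn j)]
  · by_cases h : j = k
    · subst h; simp [rectDiag, sq]
    · have : (j : ℕ) ≠ k := fun e => h (Fin.ext e)
      simp [rectDiag, h, this]
  · intro i _ hi
    have : (i : ℕ) ≠ j := fun h => hi (Fin.ext h)
    simp [rectDiag, this]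
  · simp

theorem rectDiag_mul_diagonal (s d : Fin n → ℝ) :
    rectDiag m s * diagonal d = rectDiag m fun j => s j * d j := by
  ext i j
  simp [rectDiag, Matrix.mul_diagonal, ite_mul]

theorem rectDiag_map (s : Fin n → ℝ) {f : ℝ → ℝ} (hf : f 0 = 0) :
    (rectDiag m s).map f = rectDiag m fun j => f (s j) := by
  ext i j
  simp only [rectDiag, Matrix.map_apply, Matrix.of_apply]
  split_ifs <;> simp [hf]

theorem rectDiag_mul_apply (s : Fin n → ℝ) (M : Mat n n) (i : Fin m) (j : Fin n) :
    (rectDiag m s * M) i j = if hi : (i : ℕ) < n then s ⟨i, hi⟩ * M ⟨i, hi⟩ j else 0 := by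
  rw [Matrix.mul_apply]
  split_ifs with hi
  · rw [Finset.sum_eq_single ⟨i, hi⟩]
    · simp [rectDiag]
    · intro k _ hk
      have : (i : ℕ) ≠ k := fun h => hk (Fin.ext h.symm)
      simp [rectDiag, this]
    · simp
  · refine Finset.sum_eq_zero fun k _ => ?_
    have : (i : ℕ) ≠ k := fun h => hi (h ▸ k.2)
    simp [rectDiag, this]

theorem transpose_rectDiag_mul_apply (hmn : n ≤ m) (s : Fin n → ℝ) (M : Mat m n) (i j : Fin n) :
    ((rectDiag m s)ᵀ * M) i j = s i * M (Fin.castLE hmn i) j := by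
  rw [Matrix.mul_apply, Finset.sum_eq_single (Fin.castLE hmn i)]
  · simp [rectDiag]
  · intro k _ hk
    have : (k : ℕ) ≠ i := fun h => hk (Fin.ext h)
    simp [rectDiag, this]
  · simp

theorem transpose_mul_rectDiag_apply (hmn : n ≤ m) (s : Fin n → ℝ) (M : Mat m n) (i j : Fin n) :
    (Mᵀ * rectDiag m s) i j = s j * M (Fin.castLE hmn j) i := by
  rw [← transpose_rectDiag_mul_apply hmn s M j i, ← Matrix.transpose_apply (_ * _), transpose_mul,
    transpose_transpose]

theorem roots_prod_X_sub_C_fin (r : Fin n → ℝ) :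
    (∏ j, (Polynomial.X - C (r j))).roots = Finset.univ.val.map r := by
  have : (∏ j, (Polynomial.X - C (r j))) =
      (Multiset.map (fun a => Polynomial.X - C a) (Finset.univ.val.map r)).prod := by
    rw [Multiset.map_map]; rfl
  rw [this, roots_multiset_prod_X_sub_C]

/-! ### The Gram matrix, its polynomials and the singular values in a given decomposition. -/

namespace IsSVD

variable {X : Mat m n} {U : Mat m m} {s : Fin n → ℝ} {V : Mat n n}

theorem transpose_mul_left (h : IsSVD X U s V) : Uᵀ * U = 1 := by
  simpa using (mem_orthogonalGroup_iff' (Fin m) ℝ).1 h.left_orthogonal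

theorem left_mul_transpose (h : IsSVD X U s V) : U * Uᵀ = 1 := by
  simpa using (mem_orthogonalGroup_iff (Fin m) ℝ).1 h.left_orthogonal

theorem transpose_mul_right (h : IsSVD X U s V) : Vᵀ * V = 1 := by
  simpa using (mem_orthogonalGroup_iff' (Fin n) ℝ).1 h.right_orthogonal

theorem right_mul_transpose (h : IsSVD X U s V) : V * Vᵀ = 1 := by
  simpa using (mem_orthogonalGroup_iff (Fin n) ℝ).1 h.right_orthogonal

theorem mul_right (h : IsSVD X U s V) : X * V = U * rectDiag m s := by
  rw [h.eq_mul, Matrix.mul_assoc, h.transpose_mul_right, Matrix.mul_one]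

theorem transpose_mul (h : IsSVD X U s V) : Uᵀ * X = rectDiag m s * Vᵀ := by
  rw [h.eq_mul, ← Matrix.mul_assoc, ← Matrix.mul_assoc, h.transpose_mul_left, Matrix.one_mul]

theorem gram (hmn : n ≤ m) (h : IsSVD X U s V) :
    Xᵀ * X = V * diagonal (fun j => s j ^ 2) * Vᵀ := by
  rw [← rectDiag_transpose_mul_self hmn]
  nth_rw 1 [h.eq_mul]
  simp only [Matrix.transpose_mul, transpose_transpose, Matrix.mul_assoc]
  rw [h.transpose_mul]

theorem aeval_gram (hmn : n ≤ m) (h : IsSVD X U s V) (p : ℝ[X]) :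
    aeval (Xᵀ * X) p = V * diagonal (fun j => p.eval (s j ^ 2)) * Vᵀ := by
  induction p using Polynomial.induction_on' with
  | add p q hp hq =>
    simp only [map_add, hp, hq, eval_add]
    rw [← Matrix.add_mul, ← Matrix.mul_add, diagonal_add]
  | monomial k a =>
    have : ∀ k : ℕ, (Xᵀ * X) ^ k = V * diagonal (fun j => (s j ^ 2) ^ k) * Vᵀ := by
      intro k
      induction k with
      | zero => simp [h.right_mul_transpose]
      | succ k ih =>
        rw [pow_succ, ih, h.gram hmn]
        calc _ = V * diagonal (fun j => (s j ^ 2) ^ k) * (Vᵀ * V) *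
              diagonal (fun j => s j ^ 2) * Vᵀ := by simp only [Matrix.mul_assoc]
          _ = _ := by
            rw [h.transpose_mul_right, Matrix.mul_one, Matrix.mul_assoc V, diagonal_mul_diagonal]
            simp [pow_succ]
    rw [aeval_monomial, this]
    have e : (fun j => ((monomial k) a).eval (s j ^ 2)) = a • fun j => (s j ^ 2) ^ k := by
      ext j; simp [eval_monomial]
    rw [e, diagonal_smul]
    simp [Algebra.algebraMap_eq_smul_one]

/-- The odd polynomial spectral function `X ↦ X p(Xᵀ X)` acts on singular values. -/
theorem mul_aeval_gram (hmn : n ≤ m) (h : IsSVD X U s V) (p : ℝ[X]) :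
    X * aeval (Xᵀ * X) p = U * rectDiag m (fun j => s j * p.eval (s j ^ 2)) * Vᵀ := by
  rw [h.aeval_gram hmn, ← Matrix.mul_assoc, ← Matrix.mul_assoc, h.mul_right, Matrix.mul_assoc U,
    rectDiag_mul_diagonal]

theorem charpoly_gram (hmn : n ≤ m) (h : IsSVD X U s V) :
    (Xᵀ * X).charpoly = ∏ j, (Polynomial.X - C (s j ^ 2)) := by
  rw [h.gram hmn, Matrix.mul_assoc, charpoly_mul_comm, Matrix.mul_assoc, h.transpose_mul_right,
    Matrix.mul_one, charpoly_diagonal]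

/-- This turns statements about singular values into non-vanishing of a function that is visibly
continuous in `t` and `X`. -/
theorem det_gram_sub (hmn : n ≤ m) (h : IsSVD X U s V) (t : ℝ) :
    (t • (1 : Mat n n) - Xᵀ * X).det = ∏ j, (t - s j ^ 2) := by
  have := Matrix.eval_charpoly (Xᵀ * X) t
  rw [h.charpoly_gram hmn, eval_prod] at this
  simpa [Matrix.smul_one_eq_diagonal, Matrix.scalar_apply] using this.symm

/-- Both lists consist of the square roots of the roots of the characteristic polynomial of `Xᵀ X`.
Multisets are compared because `s` may come in any order. -/
theorem map_singVal (hmn : n ≤ m) (h : IsSVD X U s V) :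
    (Finset.univ.val.map fun j => singVal X j) = Finset.univ.val.map s := by
  have hn : Module.finrank ℝ (EuclideanSpace ℝ (Fin n)) = n := by simp
  have hc : (LinearMap.adjoint (toEuclideanLin X) ∘ₗ toEuclideanLin X).charpoly
      = (Xᵀ * X).charpoly := by
    rw [← toEuclideanLin_conjTranspose_eq_adjoint, conjTranspose_eq_transpose_of_trivial,
      toEuclideanLin_eq_toLin_orthonormal, toEuclideanLin_eq_toLin_orthonormal, ← toLin_mul,
      ← LinearMap.charpoly_toMatrix _ (EuclideanSpace.basisFun (Fin n) ℝ).toBasis,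
      LinearMap.toMatrix_toLin]
  have h1 := (toEuclideanLin X).isSymmetric_adjoint_comp_self.roots_charpoly_eq_eigenvalues hn
  rw [hc, h.charpoly_gram hmn, roots_prod_X_sub_C_fin] at h1
  have h3 := congrArg (Multiset.map Real.sqrt) h1
  simp only [Multiset.map_map, Function.comp_def] at h3
  calc _ = _ := ?_
    _ = _ := h3.symm
    _ = _ := ?_
  · refine Multiset.map_congr rfl fun j _ => ?_
    rw [singVal, LinearMap.singularValues_fin _ hn]; rfl
  · exact Multiset.map_congr rfl fun j _ => Real.sqrt_sq (h.nonneg j)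

theorem range_singVal (hmn : n ≤ m) (h : IsSVD X U s V) :
    Set.range (singVal X) = Set.range s := by
  ext a
  have := congrArg (a ∈ ·) (h.map_singVal hmn)
  simpa using this

theorem mem_noSingValEq_iff (hmn : n ≤ m) (h : IsSVD X U s V) (η : ℝ) :
    X ∈ noSingValEq m n η ↔ ∀ j, s j ≠ η := by
  have : X ∈ noSingValEq m n η ↔ η ∉ Set.range (singVal X) := by simp [noSingValEq]
  rw [this, h.range_singVal hmn]; simp

theorem isSimple_iff (hmn : n ≤ m) (h : IsSVD X U s V) :
    IsSimple X ↔ Function.Injective s := by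
  have e := h.map_singVal hmn
  have key : ∀ f : Fin n → ℝ, Function.Injective f ↔ (Finset.univ.val.map f).Nodup := by
    intro f
    rw [Multiset.nodup_map_iff_inj_on Finset.univ.nodup]
    simp [Function.Injective]
  rw [IsSimple, key, key, ← e]

theorem isFullRank (hmn : n ≤ m) (h : IsSVD X U s V) (hs : ∀ j, s j ≠ 0) : IsFullRank X := by
  have hu : IsUnit (Xᵀ * X).det := by
    have := h.det_gram_sub hmn 0
    rw [zero_smul, zero_sub, det_neg] at this
    refine isUnit_iff_ne_zero.2 fun h0 => ?_
    rw [h0, mul_zero] at this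
    exact Finset.prod_ne_zero_iff.2 (fun j _ => by simpa using hs j) this.symm
  rw [IsFullRank, ← rank_transpose_mul_self, rank_of_isUnit _ ((isUnit_iff_isUnit_det _).2 hu)]
  simp

end IsSVD

/-! ### Derivatives of polynomial spectral functions. -/

section Calculus

open scoped Matrix.Norms.Elementwise

/-- Matrix multiplication as a continuous bilinear map. -/
def mulCLM (k m n : ℕ) : Mat k m →L[ℝ] Mat m n →L[ℝ] Mat k n :=
  (LinearMap.mk₂ ℝ (fun (A : Mat k m) (B : Mat m n) => A * B) (fun _ _ _ => Matrix.add_mul _ _ _)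
    (fun _ _ _ => Matrix.smul_mul _ _ _) (fun _ _ _ => Matrix.mul_add _ _ _)
    (fun _ _ _ => Matrix.mul_smul _ _ _)).toContinuousBilinearMap

/-- Transposition as a continuous linear map. -/
def transposeCLM (m n : ℕ) : Mat m n →L[ℝ] Mat n m :=
  (transposeLinearEquiv (Fin m) (Fin n) ℝ ℝ).toLinearMap.toContinuousLinearMap

theorem contDiff_gram : ContDiff ℝ ⊤ fun X : Mat m n => Xᵀ * X :=
  ((mulCLM n m n).contDiff.comp (transposeCLM m n).contDiff).clm_apply contDiff_id

theorem contDiff_mul_fun {k l : ℕ} {E : Type*} [NormedAddCommGroup E] [NormedSpace ℝ E]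
    {f : E → Mat k m} {g : E → Mat m l} (hf : ContDiff ℝ ⊤ f) (hg : ContDiff ℝ ⊤ g) :
    ContDiff ℝ ⊤ fun x => f x * g x :=
  (((mulCLM k m l).contDiff.comp hf).clm_apply hg :)

theorem hasFDerivAt_mul_fun {k l : ℕ} {E : Type*} [NormedAddCommGroup E] [NormedSpace ℝ E]
    {f : E → Mat k m} {g : E → Mat m l} {f' : E →L[ℝ] Mat k m} {g' : E →L[ℝ] Mat m l} {x : E}
    (hf : HasFDerivAt f f' x) (hg : HasFDerivAt g g' x) :
    ∃ L : E →L[ℝ] Mat k l, HasFDerivAt (fun x => f x * g x) L x ∧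
      ∀ h, L h = f x * g' h + f' h * g x :=
  ⟨_, (mulCLM k m l).hasFDerivAt_of_bilinear hf hg, fun _ => rfl⟩

theorem contDiff_aeval_gram (p : ℝ[X]) :
    ContDiff ℝ ⊤ fun X : Mat m n => aeval (Xᵀ * X) p := by
  induction p using Polynomial.induction_on with
  | C a => simpa using contDiff_const
  | add p q hp hq => simpa using hp.add hq
  | monomial k a ih =>
    have : ∀ X : Mat m n, aeval (Xᵀ * X) (C a * Polynomial.X ^ (k + 1))
        = aeval (Xᵀ * X) (C a * Polynomial.X ^ k) * (Xᵀ * X) := fun X => by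
      simp [pow_succ, mul_assoc]
    simp only [this]
    exact contDiff_mul_fun ih contDiff_gram

theorem contDiff_mul_aeval_gram (p : ℝ[X]) :
    ContDiff ℝ ⊤ fun X : Mat m n => X * aeval (Xᵀ * X) p :=
  contDiff_mul_fun contDiff_id (contDiff_aeval_gram p)

end Calculus

/-- The statement refers only to the product topology on matrices; a norm enters in the proof alone.
-/
theorem hasFDerivAt_matrix_mul {k l a b : ℕ} {f : Mat a b → Mat k m} {g : Mat a b → Mat m l}
    {f' : Mat a b →L[ℝ] Mat k m} {g' : Mat a b →L[ℝ] Mat m l} {X : Mat a b}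
    (hf : HasFDerivAt f f' X) (hg : HasFDerivAt g g' X) :
    ∃ L : Mat a b →L[ℝ] Mat k l, HasFDerivAt (fun X => f X * g X) L X ∧
      ∀ H, L H = f X * g' H + f' H * g X := by
  let _ : NormedAddCommGroup (Mat a b) := Matrix.normedAddCommGroup
  let _ : NormedSpace ℝ (Mat a b) := Matrix.normedSpace
  exact hasFDerivAt_mul_fun hf hg

theorem hasFDerivAt_matrix_add {k l a b : ℕ} {f g : Mat a b → Mat k l}
    {f' g' : Mat a b →L[ℝ] Mat k l} {X : Mat a b}
    (hf : HasFDerivAt f f' X) (hg : HasFDerivAt g g' X) :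
    HasFDerivAt (fun X => f X + g X) (f' + g') X := by
  let _ : ∀ i j : ℕ, NormedAddCommGroup (Mat i j) := fun _ _ => Matrix.normedAddCommGroup
  let _ : ∀ i j : ℕ, NormedSpace ℝ (Mat i j) := fun _ _ => Matrix.normedSpace
  exact HasFDerivAt.add hf hg

theorem hasFDerivAt_gram (X : Mat m n) :
    ∃ L : Mat m n →L[ℝ] Mat n n, HasFDerivAt (fun X : Mat m n => Xᵀ * X) L X ∧
      ∀ H, L H = Xᵀ * H + Hᵀ * X :=
  hasFDerivAt_matrix_mul (transposeCLM m n).hasFDerivAt (hasFDerivAt_id X)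

/-- Leibniz rule for divided differences with second factor `x`. It matches the product rule in the
induction on the polynomial below. -/
theorem dslope_mul_id {p : ℝ → ℝ} (hp : Differentiable ℝ p) (a b : ℝ) :
    dslope (fun x => p x * x) a b = p a + dslope p a b * b := by
  by_cases h : b = a
  · subst h
    rw [dslope_same, dslope_same, deriv_fun_mul (hp b) differentiableAt_fun_id]
    simp [add_comm]
  · have : b - a ≠ 0 := sub_ne_zero.2 h
    rw [dslope_of_ne _ h, dslope_of_ne _ h, slope_def_field, slope_def_field]
    field_simp
    ring

theorem dslope_add_fun {p q : ℝ → ℝ} (hp : Differentiable ℝ p) (hq : Differentiable ℝ q)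
    (a b : ℝ) : dslope (fun x => p x + q x) a b = dslope p a b + dslope q a b := by
  by_cases h : b = a
  · subst h
    simp only [dslope_same]
    exact deriv_fun_add (hp b) (hq b)
  · simp only [dslope_of_ne _ h, slope_def_field]
    ring

/-- The matrix of divided differences of `g` at the squares of `s`. -/
def loewner {n : ℕ} (g : ℝ → ℝ) (s : Fin n → ℝ) : Mat n n :=
  Matrix.of fun i j => dslope g (s i ^ 2) (s j ^ 2)

/-- The Daleckii–Krein formula. When `p` is multiplied by the variable, the derivative and the
divided differences obey the same recursion, so induction suffices. -/
theorem IsSVD.hasFDerivAt_aeval_gram (hmn : n ≤ m) {X : Mat m n} {U : Mat m m} {s : Fin n → ℝ}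
    {V : Mat n n} (h : IsSVD X U s V) (p : ℝ[X]) :
    ∃ L : Mat m n →L[ℝ] Mat n n, HasFDerivAt (fun X : Mat m n => aeval (Xᵀ * X) p) L X ∧
      ∀ H, Vᵀ * L H * V = loewner (fun x => p.eval x) s ⊙ (Vᵀ * (Xᵀ * H + Hᵀ * X) * V) := by
  induction p using Polynomial.induction_on with
  | C a =>
    refine ⟨0, by simpa using hasFDerivAt_const _ _, fun H => ?_⟩
    ext i j
    simp only [loewner, eval_C]
    by_cases hij : s j ^ 2 = s i ^ 2
    · simp [hij, dslope_same]
    · simp [dslope_of_ne _ hij, slope_def_field]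
  | add p q hp hq =>
    obtain ⟨L, hL, eL⟩ := hp
    obtain ⟨K, hK, eK⟩ := hq
    refine ⟨L + K, by simpa using hasFDerivAt_matrix_add hL hK, fun H => ?_⟩
    rw [_root_.add_apply, Matrix.mul_add, Matrix.add_mul, eL, eK]
    ext i j
    simp [loewner, dslope_add_fun p.differentiable q.differentiable, add_mul]
  | monomial k a ih =>
    obtain ⟨L, hL, eL⟩ := ih
    have e : ∀ X : Mat m n, aeval (Xᵀ * X) (C a * Polynomial.X ^ (k + 1))
        = aeval (Xᵀ * X) (C a * Polynomial.X ^ k) * (Xᵀ * X) := fun X => by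
      simp [pow_succ, mul_assoc]
    simp only [e]
    obtain ⟨K, hK, eK⟩ := hasFDerivAt_gram X
    obtain ⟨M, hM, eM⟩ := hasFDerivAt_matrix_mul hL hK
    refine ⟨M, hM, fun H => ?_⟩
    rw [eM, eK, h.aeval_gram hmn, h.gram hmn]
    set p : ℝ[X] := C a * Polynomial.X ^ k
    set B := Xᵀ * H + Hᵀ * X
    -- Conjugation by `V` makes both factors of the product rule diagonal. Entry `(i, j)` is then
    -- multiplied by `p` at `s i ^ 2` on the left and by `s j ^ 2` on the right, as in
    -- `dslope_mul_id`.
    have : Vᵀ * (V * diagonal (fun j => p.eval (s j ^ 2)) * Vᵀ * B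
          + L H * (V * diagonal (fun j => s j ^ 2) * Vᵀ)) * V
        = diagonal (fun j => p.eval (s j ^ 2)) * (Vᵀ * B * V)
          + (Vᵀ * L H * V) * diagonal (fun j => s j ^ 2) := by
      calc _ = (Vᵀ * V) * diagonal (fun j => p.eval (s j ^ 2)) * (Vᵀ * B * V)
          + (Vᵀ * L H * V) * diagonal (fun j => s j ^ 2) * (Vᵀ * V) := by
            simp only [Matrix.mul_assoc, Matrix.mul_add, Matrix.add_mul]
        _ = _ := by rw [h.transpose_mul_right, Matrix.one_mul, Matrix.mul_one]
    rw [this, eL]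
    ext i j
    have e2 : (fun x => (C a * Polynomial.X ^ (k + 1)).eval x) = fun x => p.eval x * x := by
      ext x; simp [p, pow_succ, mul_assoc]
    rw [e2]
    simp only [Matrix.add_apply, Matrix.diagonal_mul, Matrix.mul_diagonal, hadamard_apply,
      loewner, Matrix.of_apply, dslope_mul_id p.differentiable]
    ring

/-- The derivative of the spectral function with singular values `σ g(σ²)` in the direction `ζ`,
expressed in the bases of singular vectors. -/
def derivCore (g : ℝ → ℝ) (s : Fin n → ℝ) (ζ : Mat m n) : Mat m n :=
  rectDiag m s * (loewner g s ⊙ ((rectDiag m s)ᵀ * ζ + ζᵀ * rectDiag m s))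
    + ζ * diagonal fun j => g (s j ^ 2)

theorem IsSVD.fderiv_mul_aeval_gram (hmn : n ≤ m) {X : Mat m n} {U : Mat m m} {s : Fin n → ℝ}
    {V : Mat n n} (h : IsSVD X U s V) (p : ℝ[X]) (H : Mat m n) :
    fderiv ℝ (fun X : Mat m n => X * aeval (Xᵀ * X) p) X H
      = U * derivCore (fun x => p.eval x) s (Uᵀ * H * V) * Vᵀ := by
  obtain ⟨L, hL, eL⟩ := h.hasFDerivAt_aeval_gram hmn p
  obtain ⟨M, hM, eM⟩ := hasFDerivAt_matrix_mul (hasFDerivAt_id X) hL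
  have e : fderiv ℝ (fun X : Mat m n => X * aeval (Xᵀ * X) p) X = M := hM.fderiv
  have e1 : Vᵀ * (Xᵀ * H + Hᵀ * X) * V
      = (rectDiag m s)ᵀ * (Uᵀ * H * V) + (Uᵀ * H * V)ᵀ * rectDiag m s := by
    have : Vᵀ * Xᵀ = (rectDiag m s)ᵀ * Uᵀ := by
      rw [← Matrix.transpose_mul, ← Matrix.transpose_mul, h.mul_right]
    simp only [Matrix.mul_add, Matrix.add_mul, Matrix.transpose_mul, transpose_transpose]
    rw [← Matrix.mul_assoc, this]
    simp only [Matrix.mul_assoc]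
    rw [h.mul_right]
  have e2 : L H = V * (Vᵀ * L H * V) * Vᵀ := by
    calc L H = (V * Vᵀ) * L H * (V * Vᵀ) := by
          rw [h.right_mul_transpose, Matrix.one_mul, Matrix.mul_one]
      _ = _ := by simp only [Matrix.mul_assoc]
  have e3 : U * (Uᵀ * H * V) = H * V := by
    rw [← Matrix.mul_assoc, ← Matrix.mul_assoc, h.left_mul_transpose, Matrix.one_mul]
  rw [e, eM, h.aeval_gram hmn, e2, eL, e1, derivCore]
  simp only [id, ContinuousLinearMap.id_apply, Matrix.mul_add, Matrix.add_mul]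
  rw [← Matrix.mul_assoc X, ← Matrix.mul_assoc X, h.mul_right, ← Matrix.mul_assoc U (Uᵀ * H * V), e3]
  simp only [Matrix.mul_assoc]

/-! ### Polynomial approximation in `C¹`. -/

theorem exists_derivative_eq (q : ℝ[X]) : ∃ p : ℝ[X], derivative p = q := by
  induction q using Polynomial.induction_on' with
  | add p q hp hq =>
    obtain ⟨a, rfl⟩ := hp
    obtain ⟨b, rfl⟩ := hq
    exact ⟨a + b, by simp⟩
  | monomial k a =>
    refine ⟨monomial (k + 1) (a / (k + 1)), ?_⟩
    have : (k : ℝ) + 1 ≠ 0 := by positivity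
    rw [derivative_monomial]
    simp [div_mul_cancel₀ _ this]

/-- Polynomial approximation in the `C¹` sense, including divided differences. -/
theorem exists_polynomial_near_dslope {g g' : ℝ → ℝ} (hg : ∀ x, HasDerivAt g (g' x) x)
    (hc : Continuous g') {R : ℝ} (hR : 0 ≤ R) {ε : ℝ} (hε : 0 < ε) :
    ∃ p : ℝ[X], ∀ x ∈ Set.Icc 0 R, |p.eval x - g x| ≤ ε ∧
      ∀ y ∈ Set.Icc 0 R, |dslope (fun x => p.eval x) x y - dslope g x y| ≤ ε := by
  -- A derivative error of `ε / (R + 1)` gives at most `ε` on divided differences and, starting from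
  -- exact agreement at `0`, at most `ε` on values over `[0, R]`. The `+ 1` covers `R = 0`.
  have hδ : 0 < ε / (R + 1) := by positivity
  have hδε : ε / (R + 1) ≤ ε := div_le_self hε.le (by linarith)
  obtain ⟨q, hq⟩ := exists_polynomial_near_of_continuousOn 0 R g' hc.continuousOn _ hδ
  obtain ⟨p₀, rfl⟩ := exists_derivative_eq q
  set p : ℝ[X] := p₀ + C (g 0 - p₀.eval 0) with hp
  have hp0 : p.eval 0 = g 0 := by simp [hp]
  have hpd : ∀ x, HasDerivAt (fun x => p.eval x) (p₀.derivative.eval x) x := fun x => by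
    simpa [hp] using p.hasDerivAt x
  have hlip : ∀ x ∈ Set.Icc 0 R, ∀ y ∈ Set.Icc 0 R,
      |(p.eval y - g y) - (p.eval x - g x)| ≤ ε / (R + 1) * |y - x| := fun x hx y hy =>
    Convex.norm_image_sub_le_of_norm_hasDerivWithin_le
      (f := fun x => p.eval x - g x)
      (fun x _ => ((hpd x).sub (hg x)).hasDerivWithinAt) (fun x hx => (hq x hx).le)
      (convex_Icc 0 R) hx hy
  refine ⟨p, fun x hx => ⟨?_, fun y hy => ?_⟩⟩
  · have := hlip 0 ⟨le_rfl, hR⟩ x hx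
    rw [hp0, sub_self, sub_zero, sub_zero, abs_of_nonneg hx.1] at this
    calc _ ≤ _ := this
      _ ≤ ε / (R + 1) * (R + 1) := by gcongr; linarith [hx.2]
      _ = ε := div_mul_cancel₀ _ (by linarith)
  · by_cases h : y = x
    · subst h
      rw [dslope_same, dslope_same, (hpd y).deriv, (hg y).deriv]
      exact (hq y hy).le.trans hδε
    · have h0 : 0 < |y - x| := abs_pos.2 (sub_ne_zero.2 h)
      rw [dslope_of_ne _ h, dslope_of_ne _ h, slope_def_field, slope_def_field, ← sub_div, abs_div,
        div_le_iff₀ h0]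
      calc _ = |(p.eval y - g y) - (p.eval x - g x)| := by congr 1; ring
        _ ≤ _ := hlip x hx y hy
        _ ≤ _ := by gcongr

/-! ### Entrywise bounds for the derivative formula. -/

theorem abs_mul_mul_apply_le {k l : ℕ} {A : Mat k m} {M : Mat m n} {B : Mat n l} {c : ℝ}
    (hA : ∀ i j, |A i j| ≤ 1) (hB : ∀ i j, |B i j| ≤ 1) (hM : ∀ i j, |M i j| ≤ c)
    (i : Fin k) (j : Fin l) : |(A * M * B) i j| ≤ m * n * c := by
  have h1 : ∀ a, |(A * M) i a| ≤ m * c := fun a => by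
    rw [Matrix.mul_apply]
    calc _ ≤ ∑ b, |A i b * M b a| := Finset.abs_sum_le_sum_abs _ _
      _ ≤ ∑ _b : Fin m, c := Finset.sum_le_sum fun b _ => by
        rw [abs_mul]
        calc _ ≤ 1 * |M b a| := by gcongr; exact hA i b
          _ ≤ c := by rw [one_mul]; exact hM b a
      _ = _ := by simp
  rw [Matrix.mul_apply]
  calc _ ≤ ∑ a, |(A * M) i a * B a j| := Finset.abs_sum_le_sum_abs _ _
    _ ≤ ∑ _a : Fin n, m * c := Finset.sum_le_sum fun a _ => by
      rw [abs_mul]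
      calc _ ≤ |(A * M) i a| * 1 := by gcongr; exact hB a j
        _ ≤ _ := by rw [mul_one]; exact h1 a
    _ = _ := by simp; ring

theorem derivCore_apply (hmn : n ≤ m) (g : ℝ → ℝ) (s : Fin n → ℝ) (ζ : Mat m n)
    (i : Fin m) (j : Fin n) :
    derivCore g s ζ i j = (if hi : (i : ℕ) < n then
      s ⟨i, hi⟩ * (dslope g (s ⟨i, hi⟩ ^ 2) (s j ^ 2) *
        (s ⟨i, hi⟩ * ζ i j + s j * ζ (Fin.castLE hmn j) ⟨i, hi⟩)) else 0)
      + ζ i j * g (s j ^ 2) := by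
  rw [derivCore, Matrix.add_apply, rectDiag_mul_apply, Matrix.mul_diagonal]
  congr 1
  split_ifs with hi
  · rw [hadamard_apply, Matrix.add_apply, transpose_rectDiag_mul_apply hmn,
      transpose_mul_rectDiag_apply hmn]
    rfl
  · rfl

/-- The core is linear in the values and divided differences of the scalar function. The latter
carry the weights `s i * s i` and `s i * s j`, each at most `R` in absolute value. -/
theorem abs_derivCore_sub_apply_le (hmn : n ≤ m) {f g : ℝ → ℝ} {s : Fin n → ℝ} {R ε z : ℝ}
    (hs : ∀ j, s j ^ 2 ≤ R) (hR : 0 ≤ R) (hε : 0 ≤ ε) (hz : 0 ≤ z)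
    (hfg : ∀ x ∈ Set.Icc 0 R, |f x - g x| ≤ ε ∧ ∀ y ∈ Set.Icc 0 R,
      |dslope f x y - dslope g x y| ≤ ε)
    {ζ : Mat m n} (hζ : ∀ i j, |ζ i j| ≤ z) (i : Fin m) (j : Fin n) :
    |(derivCore f s ζ - derivCore g s ζ) i j| ≤ (2 * R + 1) * z * ε := by
  have hmem : ∀ j, s j ^ 2 ∈ Set.Icc 0 R := fun j => ⟨sq_nonneg _, hs j⟩
  have hss : ∀ i j, |s i * s j| ≤ R := fun i j => by
    rw [abs_le]
    constructor <;> nlinarith [hs i, hs j, sq_nonneg (s i + s j), sq_nonneg (s i - s j)]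
  have h2 : |ζ i j * (f (s j ^ 2) - g (s j ^ 2))| ≤ z * ε := by
    rw [abs_mul]
    exact mul_le_mul (hζ i j) (hfg _ (hmem j)).1 (abs_nonneg _) hz
  rw [Matrix.sub_apply, derivCore_apply hmn, derivCore_apply hmn]
  split_ifs with hi
  · set a : Fin n := ⟨i, hi⟩
    set d := dslope f (s a ^ 2) (s j ^ 2) - dslope g (s a ^ 2) (s j ^ 2) with hd
    set w := ζ (Fin.castLE hmn j) a
    have hdε : |d| ≤ ε := (hfg _ (hmem a)).2 _ (hmem j)
    have t1 : |s a * s a * ζ i j| ≤ R * z := by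
      rw [abs_mul]; exact mul_le_mul (hss a a) (hζ i j) (abs_nonneg _) hR
    have t2 : |s a * s j * w| ≤ R * z := by
      rw [abs_mul]; exact mul_le_mul (hss a j) (hζ _ _) (abs_nonneg _) hR
    have h1 : |(s a * s a * ζ i j + s a * s j * w) * d| ≤ (R * z + R * z) * ε := by
      rw [abs_mul]
      exact mul_le_mul ((abs_add_le _ _).trans (add_le_add t1 t2)) hdε (abs_nonneg _)
        (by positivity)
    calc _ = |(s a * s a * ζ i j + s a * s j * w) * d
          + ζ i j * (f (s j ^ 2) - g (s j ^ 2))| := by congr 1; rw [hd]; ring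
      _ ≤ (R * z + R * z) * ε + z * ε := (abs_add_le _ _).trans (add_le_add h1 h2)
      _ = _ := by ring
  · calc _ = |ζ i j * (f (s j ^ 2) - g (s j ^ 2))| := by congr 1; ring
      _ ≤ z * ε := h2
      _ ≤ _ := by nlinarith [mul_nonneg hR (mul_nonneg hz hε)]

theorem derivCore_add (g : ℝ → ℝ) (s : Fin n → ℝ) (ζ ξ : Mat m n) :
    derivCore g s (ζ + ξ) = derivCore g s ζ + derivCore g s ξ := by
  simp only [derivCore, Matrix.mul_add, Matrix.add_mul, transpose_add, hadamard_add]
  abel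

theorem derivCore_smul (g : ℝ → ℝ) (s : Fin n → ℝ) (c : ℝ) (ζ : Mat m n) :
    derivCore g s (c • ζ) = c • derivCore g s ζ := by
  simp [derivCore, ← smul_add]

/-- The derivative attached to the scalar function `g` and the orthogonal factors `U`, `V`. -/
def derivMap (g : ℝ → ℝ) (U : Mat m m) (s : Fin n → ℝ) (V : Mat n n) :
    Mat m n →ₗ[ℝ] Mat m n where
  toFun H := U * derivCore g s (Uᵀ * H * V) * Vᵀ
  map_add' H K := by simp [Matrix.mul_add, Matrix.add_mul, derivCore_add]
  map_smul' c H := by simp [derivCore_smul]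

theorem derivMap_apply (g : ℝ → ℝ) (U : Mat m m) (s : Fin n → ℝ) (V : Mat n n) (H : Mat m n) :
    derivMap g U s V H = U * derivCore g s (Uᵀ * H * V) * Vᵀ := rfl

/-- Entries of orthogonal matrices are at most `1`, so each of the two changes of basis costs a
factor `m * n`. The bound involves `X` only through `R`, which makes the convergence uniform. -/
theorem abs_derivMap_sub_le (hmn : n ≤ m) {X : Mat m n} {U : Mat m m} {s : Fin n → ℝ}
    {V : Mat n n} (h : IsSVD X U s V) {f g : ℝ → ℝ} {R ε z : ℝ}
    (hs : ∀ j, s j ^ 2 ≤ R) (hR : 0 ≤ R) (hε : 0 ≤ ε) (hz : 0 ≤ z)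
    (hfg : ∀ x ∈ Set.Icc 0 R, |f x - g x| ≤ ε ∧ ∀ y ∈ Set.Icc 0 R,
      |dslope f x y - dslope g x y| ≤ ε)
    {H : Mat m n} (hH : ∀ i j, |H i j| ≤ z) (i : Fin m) (j : Fin n) :
    |(derivMap f U s V H - derivMap g U s V H) i j|
      ≤ (m * n) ^ 2 * (2 * R + 1) * ε * z := by
  have hU : ∀ i j, |U i j| ≤ 1 := fun i j => entry_norm_bound_of_unitary h.left_orthogonal i j
  have hV : ∀ i j, |V i j| ≤ 1 := fun i j => entry_norm_bound_of_unitary h.right_orthogonal i j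
  have hζ : ∀ i j, |(Uᵀ * H * V) i j| ≤ m * n * z :=
    abs_mul_mul_apply_le (fun i j => hU j i) hV hH
  have e : derivMap f U s V H - derivMap g U s V H
      = U * (derivCore f s (Uᵀ * H * V) - derivCore g s (Uᵀ * H * V)) * Vᵀ := by
    simp [derivMap, Matrix.mul_sub, Matrix.sub_mul]
  rw [e]
  refine (abs_mul_mul_apply_le hU (fun i j => hV j i)
    (abs_derivCore_sub_apply_le hmn hs hR hε (by positivity) hfg hζ) i j).trans_eq ?_
  ring

/-- A pointwise limit of `C¹` maps whose derivatives converge uniformly on an open set is `C¹`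
there. -/
theorem hasFDerivAt_of_fderiv_sub_le {E F : Type*} [NormedAddCommGroup E] [NormedSpace ℝ E]
    [NormedAddCommGroup F] [NormedSpace ℝ F] {W : Set E} (hW : IsOpen W) {Φ : ℕ → E → F}
    (hΦ : ∀ k, ContDiff ℝ ⊤ (Φ k)) {f : E → F} {D : E → E →L[ℝ] F} {c : ℕ → ℝ}
    (hc₀ : ∀ k, 0 ≤ c k) (hc : Filter.Tendsto c Filter.atTop (nhds 0))
    (hbound : ∀ k, ∀ x ∈ W, ∀ h, ‖fderiv ℝ (Φ k) x h - D x h‖ ≤ c k * ‖h‖)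
    (hlim : ∀ x ∈ W, Filter.Tendsto (fun k => Φ k x) Filter.atTop (nhds (f x))) :
    (∀ x ∈ W, HasFDerivAt f (D x) x) ∧
      ∀ h, ContinuousOn (fun x => fderiv ℝ f x h) W := by
  have hunif : TendstoUniformlyOn (fun k x => fderiv ℝ (Φ k) x) D Filter.atTop W := by
    rw [Metric.tendstoUniformlyOn_iff]
    intro ε hε
    filter_upwards [hc.eventually_lt_const hε] with k hk x hx
    refine lt_of_le_of_lt ?_ hk
    rw [dist_comm, dist_eq_norm]
    exact ContinuousLinearMap.opNorm_le_bound _ (hc₀ k) fun h => hbound k x hx h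
  have hder : ∀ x ∈ W, HasFDerivAt f (D x) x := fun x hx =>
    hasFDerivAt_of_tendstoUniformlyOn hW hunif
      (fun k x _ => ((hΦ k).differentiable (by simp) x).hasFDerivAt) hlim hx
  have hD : ContinuousOn D W := hunif.continuousOn
    (Filter.Frequently.of_forall fun k => ((hΦ k).continuous_fderiv (by simp)).continuousOn)
  exact ⟨hder, fun h => (hD.congr fun x hx => (hder x hx).fderiv).clm_apply continuousOn_const⟩

/-! ### From polynomials to `C¹` spectral functions. -/

section Limit

open scoped Matrix.Norms.Elementwise

theorem contDiffOn_spectral (hmn : n ≤ m) {g g' : ℝ → ℝ} (hg : ∀ x, HasDerivAt g (g' x) x)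
    (hc : Continuous g') {R : ℝ} (hR : 0 ≤ R) {W : Set (Mat m n)} (hW : IsOpen W)
    (hWR : ∀ X ∈ W, ∀ U s V, IsSVD X U s V → ∀ j, s j ^ 2 ≤ R) {f : Mat m n → Mat m n}
    (hf : ∀ X ∈ W, ∀ U s V, IsSVD X U s V →
      f X = U * rectDiag m (fun j => s j * g (s j ^ 2)) * Vᵀ) :
    (∀ X ∈ W, DifferentiableAt ℝ f X) ∧ (∀ H, ContinuousOn (fun X => fderiv ℝ f X H) W) ∧
      ∀ X ∈ W, ∀ U s V, IsSVD X U s V → ∀ H, fderiv ℝ f X H = derivMap g U s V H := by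
  choose p hp using fun k : ℕ =>
    exists_polynomial_near_dslope hg hc hR (Nat.one_div_pos_of_nat (α := ℝ) (n := k))
  choose U s V hsvd using fun X : Mat m n => exists_isSVD hmn X
  let Φ : ℕ → Mat m n → Mat m n := fun k X => X * aeval (Xᵀ * X) (p k)
  have hΦ : ∀ k, ContDiff ℝ ⊤ (Φ k) := fun k => contDiff_mul_aeval_gram (p k)
  -- The chosen decompositions need not depend continuously on `X`. Continuity of `D` comes from its
  -- being a uniform limit of continuous derivatives.
  let D : Mat m n → Mat m n →L[ℝ] Mat m n := fun X =>
    (derivMap g (U X) (s X) (V X)).toContinuousLinearMap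
  set c : ℝ := (m * n) ^ 2 * (2 * R + 1) with hcdef
  have hc0 : 0 ≤ c := by positivity
  have hbound : ∀ k, ∀ X ∈ W, ∀ U s V, IsSVD X U s V → ∀ H,
      ‖fderiv ℝ (Φ k) X H - derivMap g U s V H‖ ≤ c * (1 / ((k : ℝ) + 1)) * ‖H‖ := by
    intro k X hX U s V h H
    have e : fderiv ℝ (Φ k) X H = derivMap (fun x => (p k).eval x) U s V H :=
      h.fderiv_mul_aeval_gram hmn (p k) H
    rw [e, Matrix.norm_le_iff (by positivity)]
    exact abs_derivMap_sub_le hmn h (hWR X hX U s V h) hR (by positivity) (norm_nonneg H) (hp k)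
      fun i j => Matrix.norm_entry_le_entrywise_sup_norm H
  have hlim : Filter.Tendsto (fun k : ℕ => c * (1 / ((k : ℝ) + 1))) Filter.atTop (nhds 0) := by
    simpa using tendsto_one_div_add_atTop_nhds_zero_nat.const_mul c
  have hpt : ∀ X ∈ W, Filter.Tendsto (fun k => Φ k X) Filter.atTop (nhds (f X)) := by
    intro X hX
    have hs := hWR X hX _ _ _ (hsvd X)
    rw [hf X hX _ _ _ (hsvd X)]
    simp only [Φ, (hsvd X).mul_aeval_gram hmn]
    have h1 : ∀ j, Filter.Tendsto (fun k => (p k).eval (s X j ^ 2)) Filter.atTop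
        (nhds (g (s X j ^ 2))) := fun j => by
      rw [tendsto_iff_norm_sub_tendsto_zero]
      exact squeeze_zero (fun _ => norm_nonneg _) (fun k => (hp k _ ⟨sq_nonneg _, hs j⟩).1)
        tendsto_one_div_add_atTop_nhds_zero_nat
    have h2 : Filter.Tendsto (fun k => rectDiag m fun j => s X j * (p k).eval (s X j ^ 2))
        Filter.atTop (nhds (rectDiag m fun j => s X j * g (s X j ^ 2))) := by
      refine tendsto_pi_nhds.2 fun i => tendsto_pi_nhds.2 fun j => ?_
      simp only [rectDiag, Matrix.of_apply]
      split_ifs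
      · exact (h1 j).const_mul _
      · exact tendsto_const_nhds
    have hcont : Continuous fun M : Mat m n => U X * M * (V X)ᵀ :=
      (continuous_const.matrix_mul continuous_id).matrix_mul continuous_const
    exact (hcont.tendsto _).comp h2
  obtain ⟨hder, hcont⟩ := hasFDerivAt_of_fderiv_sub_le (D := D) hW hΦ (fun k => by positivity) hlim
    (fun k X hX H => hbound k X hX _ _ _ (hsvd X) H) hpt
  refine ⟨fun X hX => (hder X hX).differentiableAt, hcont, ?_⟩
  · intro X hX U' s' V' h H
    have hlimH : Filter.Tendsto (fun k : ℕ => c * (1 / ((k : ℝ) + 1)) * ‖H‖) Filter.atTop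
        (nhds 0) := by simpa using hlim.mul_const ‖H‖
    -- For every decomposition of `X` the formula is the limit of the same sequence of derivatives,
    -- hence all decompositions give the same value.
    have hT : ∀ U s V, IsSVD X U s V → Filter.Tendsto (fun k => fderiv ℝ (Φ k) X H) Filter.atTop
        (nhds (derivMap g U s V H)) := fun U s V h => by
      refine tendsto_iff_norm_sub_tendsto_zero.2 ?_
      exact squeeze_zero (fun _ => norm_nonneg _) (fun k => hbound k X hX U s V h H) hlimH
    have e : fderiv ℝ f X H = D X H := DFunLike.congr_fun (hder X hX).fderiv H
    refine e.trans ?_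
    exact tendsto_nhds_unique (hT _ _ _ (hsvd X)) (hT _ _ _ h)

end Limit

/-- A spectral function `f` acting on singular values as `σ ↦ σ g(σ²)`, with `g` of class `C¹`, is
continuously differentiable, with derivative given by divided differences. -/
theorem fderiv_spectral (hmn : n ≤ m) {g : ℝ → ℝ} (hg : ContDiff ℝ 1 g) {R : ℝ} (hR : 0 ≤ R)
    {W : Set (Mat m n)} (hW : IsOpen W)
    (hWR : ∀ X ∈ W, ∀ U s V, IsSVD X U s V → ∀ j, s j ^ 2 ≤ R) {f : Mat m n → Mat m n}
    (hf : ∀ X ∈ W, ∀ U s V, IsSVD X U s V →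
      f X = U * rectDiag m (fun j => s j * g (s j ^ 2)) * Vᵀ) :
    (∀ X ∈ W, DifferentiableAt ℝ f X) ∧ (∀ H, ContinuousOn (fun X => fderiv ℝ f X H) W) ∧
      ∀ X ∈ W, ∀ U s V, IsSVD X U s V → ∀ H, fderiv ℝ f X H = derivMap g U s V H := by
  obtain ⟨h1, h2, h3⟩ := contDiffOn_spectral hmn
    (fun x => (hg.differentiable (by simp) x).hasDerivAt) (hg.continuous_deriv le_rfl) hR hW hWR hf
  exact ⟨h1, h2, h3⟩

/-! ### Soft thresholding as a spectral function. -/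

theorem softThreshold_of_le {η t : ℝ} (h : t ≤ η) : softThreshold η t = 0 :=
  max_eq_right (sub_nonpos.2 h)

theorem softThreshold_of_ge {η t : ℝ} (h : η ≤ t) : softThreshold η t = t - η :=
  max_eq_left (sub_nonneg.2 h)

/-- Applying a scalar function to the singular values does not depend on the decomposition. -/
theorem IsSVD.mul_map_mul_eq (hmn : n ≤ m) {X : Mat m n} {U U' : Mat m m} {s s' : Fin n → ℝ}
    {V V' : Mat n n} (h : IsSVD X U s V) (h' : IsSVD X U' s' V') {f : ℝ → ℝ} (hf : f 0 = 0) :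
    U * (rectDiag m s).map f * Vᵀ = U' * (rectDiag m s').map f * V'ᵀ := by
  classical
  let N : Finset ℝ := Finset.univ.image (fun j => s j ^ 2) ∪ Finset.univ.image (fun j => s' j ^ 2)
  -- Interpolation at the squared singular values of both decompositions makes each side equal to `X
  -- p(Xᵀ X)`. The node value at `0` is immaterial, since it is multiplied by `t = 0`.
  let p : ℝ[X] := Lagrange.interpolate N id fun t => f √t / √t
  have key : ∀ t, 0 ≤ t → t ^ 2 ∈ N → t * p.eval (t ^ 2) = f t := by
    intro t ht hN
    have : p.eval (t ^ 2) = f √(t ^ 2) / √(t ^ 2) :=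
      Lagrange.eval_interpolate_at_node (v := id) _ (Function.injective_id.injOn) hN
    rw [this, Real.sqrt_sq ht]
    rcases ht.eq_or_lt with rfl | h0
    · simp [hf]
    · field_simp
  have e : ∀ j, s j * p.eval (s j ^ 2) = f (s j) := fun j => key _ (h.nonneg j) (by simp [N])
  have e' : ∀ j, s' j * p.eval (s' j ^ 2) = f (s' j) := fun j => key _ (h'.nonneg j) (by simp [N])
  rw [rectDiag_map _ hf, rectDiag_map _ hf, ← funext e, ← funext e', ← h.mul_aeval_gram hmn,
    ← h'.mul_aeval_gram hmn]

theorem IsSVD.svt_eq (hmn : n ≤ m) {η : ℝ} (hη : 0 < η) {X : Mat m n} {U : Mat m m}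
    {s : Fin n → ℝ} {V : Mat n n} (h : IsSVD X U s V) :
    svt hmn η X = U * (rectDiag m s).map (softThreshold η) * Vᵀ :=
  (exists_isSVD hmn X).choose_spec.choose_spec.choose_spec.mul_map_mul_eq hmn h
    (softThreshold_of_le hη.le)

/-- Away from `η`, soft thresholding is `t ↦ t g(t²)` for a `C¹` function `g`. -/
theorem exists_contDiff_softThreshold {η δ : ℝ} (hη : 0 < η) (hδ : 0 < δ) (hδη : δ < η ^ 2) :
    ∃ g : ℝ → ℝ, ContDiff ℝ 1 g ∧
      ∀ t, -η < t → δ ≤ |t ^ 2 - η ^ 2| → softThreshold η t = t * g (t ^ 2) := by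
  -- The cutoff rises from `0` to `1` across `[η² - δ, η² + δ]`. Above this gap `t - η = t (1 - η /
  -- √(t²))`; below it both sides vanish.
  let φ : ℝ → ℝ := fun x => Real.smoothTransition ((x - (η ^ 2 - δ)) / (2 * δ))
  have hφ : ContDiff ℝ 1 φ :=
    Real.smoothTransition.contDiff.comp ((contDiff_id.sub contDiff_const).div_const _)
  have hφ0 : ∀ x ≤ η ^ 2 - δ, φ x = 0 := fun x hx =>
    Real.smoothTransition.zero_of_nonpos
      (div_nonpos_of_nonpos_of_nonneg (by linarith) (by linarith))
  have hφ1 : ∀ x, η ^ 2 + δ ≤ x → φ x = 1 := fun x hx =>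
    Real.smoothTransition.one_of_one_le ((one_le_div (by linarith)).2 (by linarith))
  refine ⟨fun x => φ x * (1 - η / √x), contDiff_iff_contDiffAt.2 fun x => ?_, fun t ht hd => ?_⟩
  · rcases lt_or_ge 0 x with hx | hx
    · exact hφ.contDiffAt.mul (contDiffAt_const.sub
        (contDiffAt_const.div (Real.contDiffAt_sqrt hx.ne') (Real.sqrt_pos.2 hx).ne'))
    · have : (fun x => φ x * (1 - η / √x)) =ᶠ[nhds x] fun _ => 0 := by
        filter_upwards [Iio_mem_nhds (show x < η ^ 2 - δ by linarith)] with y hy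
        rw [hφ0 y (le_of_lt hy), zero_mul]
      exact contDiffAt_const.congr_of_eventuallyEq this
  · rcases le_abs.1 hd with h | h
    · have h1 : η < t := by nlinarith
      have h2 : 0 < t := hη.trans h1
      have hφt : φ (t ^ 2) = 1 := hφ1 _ (by linarith)
      simp only [softThreshold_of_ge h1.le, hφt, Real.sqrt_sq h2.le]
      field_simp
    · have h1 : t ≤ η := by nlinarith
      have hφt : φ (t ^ 2) = 0 := hφ0 _ (by linarith)
      simp [softThreshold_of_le h1, hφt]

theorem IsSVD.sq_le_trace_gram (hmn : n ≤ m) {X : Mat m n} {U : Mat m m}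
    {s : Fin n → ℝ} {V : Mat n n} (h : IsSVD X U s V) (j : Fin n) : s j ^ 2 ≤ (Xᵀ * X).trace := by
  rw [h.gram hmn, Matrix.mul_assoc, trace_mul_comm, Matrix.mul_assoc, h.transpose_mul_right,
    Matrix.mul_one, trace_diagonal]
  exact Finset.single_le_sum (f := fun j => s j ^ 2) (fun i _ => sq_nonneg _) (Finset.mem_univ j)

/-- Locally, singular values are bounded and stay away from a number that is not one of them. -/
theorem exists_isOpen_singular_gap (hmn : n ≤ m) {η : ℝ} (hη : 0 < η) {X₀ : Mat m n}
    (hX₀ : X₀ ∈ noSingValEq m n η) :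
    ∃ δ R : ℝ, ∃ W : Set (Mat m n), 0 < δ ∧ δ < η ^ 2 ∧ 0 ≤ R ∧ IsOpen W ∧ X₀ ∈ W ∧
      ∀ X ∈ W, ∀ U s V, IsSVD X U s V → ∀ j, δ < |s j ^ 2 - η ^ 2| ∧ s j ^ 2 ≤ R := by
  obtain ⟨U₀, s₀, V₀, h₀⟩ := exists_isSVD hmn X₀
  have hgram : Continuous fun X : Mat m n => Xᵀ * X :=
    (continuous_id.matrix_transpose).matrix_mul continuous_id
  -- Joint continuity in `t` and `X` keeps the determinant non-zero on a product neighbourhood of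
  -- `(η², X₀)`. No continuity of singular values is needed.
  have hdet : Continuous fun q : ℝ × Mat m n => (q.1 • (1 : Mat n n) - q.2ᵀ * q.2).det :=
    ((continuous_fst.smul continuous_const).sub (hgram.comp continuous_snd)).matrix_det
  have hne : (η ^ 2 • (1 : Mat n n) - X₀ᵀ * X₀).det ≠ 0 := by
    rw [h₀.det_gram_sub hmn]
    refine Finset.prod_ne_zero_iff.2 fun j _ h => ?_
    have : s₀ j = η := by
      have := h₀.nonneg j
      exact (pow_left_inj₀ this hη.le two_ne_zero).1 (by linarith)
    exact (h₀.mem_noSingValEq_iff hmn η).1 hX₀ j this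
  have hev := hdet.continuousAt.eventually_ne (x := (η ^ 2, X₀)) hne
  rw [nhds_prod_eq] at hev
  obtain ⟨P, hP, Q, hQ, hPQ⟩ := Filter.eventually_prod_iff.1 hev
  obtain ⟨ε, hε, hεP⟩ := Metric.eventually_nhds_iff.1 hP
  obtain ⟨W, hWQ, hW, hX₀W⟩ := eventually_nhds_iff.1 hQ
  -- Halving `ε` makes the gap strict, the second term ensures `δ < η ^ 2`, and the trace bounds
  -- every squared singular value.
  refine ⟨min (ε / 2) (η ^ 2 / 2), (X₀ᵀ * X₀).trace + 1,
    W ∩ {X | (Xᵀ * X).trace < (X₀ᵀ * X₀).trace + 1}, by positivity,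
    (min_le_right _ _).trans_lt (half_lt_self (by positivity)), ?_,
    hW.inter (isOpen_lt hgram.matrix_trace continuous_const), ⟨hX₀W, by simp⟩, ?_⟩
  · have : 0 ≤ (X₀ᵀ * X₀).trace := by
      rw [h₀.gram hmn, Matrix.mul_assoc, trace_mul_comm, Matrix.mul_assoc, h₀.transpose_mul_right,
        Matrix.mul_one, trace_diagonal]
      exact Finset.sum_nonneg fun i _ => sq_nonneg _
    linarith
  · rintro X ⟨hXW, hXR⟩ U s V h j
    refine ⟨?_, (h.sq_le_trace_gram hmn j).trans (le_of_lt hXR)⟩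
    by_contra! hle
    have hlt : dist (s j ^ 2) (η ^ 2) < ε := by
      rw [Real.dist_eq]
      linarith [min_le_left (ε / 2) (η ^ 2 / 2)]
    refine hPQ (hεP hlt) (hWQ X hXW) ?_
    change (s j ^ 2 • (1 : Mat n n) - Xᵀ * X).det = 0
    rw [h.det_gram_sub hmn]
    exact Finset.prod_eq_zero (Finset.mem_univ j) (sub_self _)

/-! ### The coefficients of `Γ` as divided differences. -/

/-- After substituting `t g(t²)` for the threshold, the branches of `Q` and `T` become cases of one
formula each: the quotient for `a ≠ b`, and the derivative of `g` for `a = b`. -/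
theorem coeff_eq_dslope {η a b : ℝ} {g : ℝ → ℝ} (ha : 0 ≤ a) (hb : 0 ≤ b)
    (hTa : softThreshold η a = a * g (a ^ 2)) (hTb : softThreshold η b = b * g (b ^ 2))
    (hda : deriv (softThreshold η) a = g (a ^ 2) + 2 * a ^ 2 * deriv g (a ^ 2)) :
    coeffQ η a b = g (b ^ 2) + a ^ 2 * dslope g (a ^ 2) (b ^ 2) ∧
      coeffT η a b = a * b * dslope g (a ^ 2) (b ^ 2) := by
  by_cases hab : a = b
  · subst hab
    rw [dslope_same]
    rcases ha.eq_or_lt with rfl | h0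
    · simp [coeffQ, coeffT, hda]
    · simp only [coeffQ, coeffT, h0, and_self, if_true, hda, hTa]
      constructor <;> field_simp <;> ring
  · have hne : b ^ 2 ≠ a ^ 2 := fun h => hab ((pow_left_inj₀ hb ha two_ne_zero).1 h).symm
    have h1 : b ^ 2 - a ^ 2 ≠ 0 := sub_ne_zero.2 hne
    have h2 : a ^ 2 - b ^ 2 ≠ 0 := sub_ne_zero.2 hne.symm
    simp only [coeffQ, coeffT, hab, false_and, if_false, hTa, hTb, dslope_of_ne _ hne,
      slope_def_field]
    constructor <;> field_simp <;> ring

/-- On the diagonal the entries `ζ i j` and `ζ j i` coincide and their coefficients add up to the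
derivative of the threshold. In the rows from `n` on only the factor `g(σ²)` survives, which is `R`.
-/
theorem Gam_eq_derivCore (hmn : n ≤ m) {η : ℝ} {s : Fin n → ℝ} {g : ℝ → ℝ} (hs : ∀ j, 0 ≤ s j)
    (hT : ∀ j, softThreshold η (s j) = s j * g (s j ^ 2))
    (hd : ∀ j, deriv (softThreshold η) (s j) = g (s j ^ 2) + 2 * s j ^ 2 * deriv g (s j ^ 2))
    (ζ : Mat m n) : Gam hmn η s ζ = derivCore g s ζ := by
  ext i j
  rw [derivCore_apply hmn, Gam, Matrix.of_apply]
  split_ifs with hi hij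
  · have h1 : (⟨i, hi⟩ : Fin n) = j := Fin.ext hij
    have h2 : Fin.castLE hmn j = i := Fin.ext hij.symm
    rw [h1, h2, hd, dslope_same]
    ring
  · obtain ⟨hQ, hT'⟩ := coeff_eq_dslope (hs ⟨i, hi⟩) (hs j) (hT _) (hT _) (hd _)
    rw [hQ, hT']
    ring
  · have : coeffR η (s j) = g (s j ^ 2) := by
      rcases (hs j).eq_or_lt with h0 | h0
      · have := hd j
        rw [← h0] at this
        simp [coeffR, ← h0, this]
      · rw [coeffR, if_pos h0, hT]
        field_simp
    rw [this]
    ring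

/-! ### Self-adjointness of the derivative. -/

theorem dslope_comm (g : ℝ → ℝ) (a b : ℝ) : dslope g a b = dslope g b a := by
  by_cases h : b = a
  · rw [h]
  · rw [dslope_of_ne _ h, dslope_of_ne _ (Ne.symm h), slope_comm]

theorem loewner_transpose (g : ℝ → ℝ) (s : Fin n → ℝ) : (loewner g s)ᵀ = loewner g s := by
  ext i j
  exact dslope_comm g _ _

theorem trace_mul_hadamard (P L S : Mat n n) : (P * (L ⊙ S)).trace = ((Lᵀ ⊙ P) * S).trace := by
  simp only [Matrix.trace, Matrix.diag_apply, Matrix.mul_apply, hadamard_apply, transpose_apply]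
  exact Finset.sum_congr rfl fun i _ => Finset.sum_congr rfl fun j _ => by ring

theorem two_mul_trace_mul {A N : Mat n n} (hN : Nᵀ = N) :
    2 * (A * N).trace = ((A + Aᵀ) * N).trace := by
  have : (Aᵀ * N).trace = (A * N).trace := by
    rw [← trace_transpose, Matrix.transpose_mul, transpose_transpose, hN, trace_mul_comm]
  rw [Matrix.add_mul, trace_add, this, two_mul]

theorem frobInner_comm (A B : Mat m n) : frobInner A B = frobInner B A := by
  rw [frobInner, ← trace_transpose, Matrix.transpose_mul, transpose_transpose, frobInner]

/-- Write `S ξ = Dᵀ ξ + ξᵀ D` and `L` for the matrix of divided differences. As `L ⊙ S ξ` is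
symmetric, twice the pairing of `ζ` with `D (L ⊙ S ξ)` is the trace of `S ζ (L ⊙ S ξ)`. Symmetry of
`L` makes this symmetric in `ζ` and `ξ`. -/
theorem frobInner_derivCore (g : ℝ → ℝ) (s : Fin n → ℝ) (ζ ξ : Mat m n) :
    frobInner ζ (derivCore g s ξ) = frobInner (derivCore g s ζ) ξ := by
  set D := rectDiag m s
  set S : Mat m n → Mat n n := fun ξ => Dᵀ * ξ + ξᵀ * D with hS
  have hST : ∀ ξ, (S ξ)ᵀ = S ξ := fun ξ => by
    simp [hS, Matrix.transpose_mul, add_comm]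
  have hN : ∀ ξ, (loewner g s ⊙ S ξ)ᵀ = loewner g s ⊙ S ξ := fun ξ => by
    conv_rhs => rw [← loewner_transpose g s, ← hST ξ]
    rfl
  have e : ∀ ζ ξ : Mat m n, 2 * frobInner ζ (D * (loewner g s ⊙ S ξ))
      = (S ζ * (loewner g s ⊙ S ξ)).trace := fun ζ ξ => by
    rw [frobInner, ← Matrix.mul_assoc, two_mul_trace_mul (hN ξ), Matrix.transpose_mul,
      transpose_transpose, add_comm]
  have e1 : frobInner ζ (D * (loewner g s ⊙ S ξ)) = frobInner ξ (D * (loewner g s ⊙ S ζ)) := by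
    have : 2 * frobInner ζ (D * (loewner g s ⊙ S ξ))
        = 2 * frobInner ξ (D * (loewner g s ⊙ S ζ)) := by
      rw [e, e, trace_mul_hadamard, loewner_transpose, trace_mul_comm]
    linarith
  have e2 : frobInner ζ (ξ * diagonal fun j => g (s j ^ 2))
      = frobInner ξ (ζ * diagonal fun j => g (s j ^ 2)) := by
    rw [frobInner_comm ξ, frobInner, frobInner, Matrix.transpose_mul, diagonal_transpose,
      ← Matrix.mul_assoc, trace_mul_comm, Matrix.mul_assoc]
  have hadd : ∀ A B C : Mat m n, frobInner A (B + C) = frobInner A B + frobInner A C :=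
    fun A B C => by simp [frobInner, Matrix.mul_add]
  rw [frobInner_comm (derivCore g s ζ), derivCore, derivCore, hadd, hadd]
  exact congrArg₂ (· + ·) e1 e2

theorem frobInner_mul_mul (U : Mat m m) (V : Mat n n) (A B : Mat m n) :
    frobInner A (U * B * Vᵀ) = frobInner (Uᵀ * A * V) B := by
  simp only [frobInner, Matrix.transpose_mul, transpose_transpose]
  rw [← Matrix.mul_assoc, trace_mul_comm]
  simp only [Matrix.mul_assoc]

theorem frobInner_derivMap (g : ℝ → ℝ) (U : Mat m m) (s : Fin n → ℝ) (V : Mat n n)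
    (A B : Mat m n) : frobInner A (derivMap g U s V B) = frobInner (derivMap g U s V A) B := by
  rw [frobInner_comm (derivMap g U s V A), derivMap_apply, derivMap_apply, frobInner_mul_mul,
    frobInner_mul_mul, frobInner_derivCore, frobInner_comm]

theorem frobInner_single (A : Mat m n) (i : Fin m) (j : Fin n) :
    frobInner A (Matrix.single i j 1) = A i j := by
  simp [frobInner, Matrix.trace_mul_single]

theorem frobAdjoint_eq_derivMap {L : Mat m n →L[ℝ] Mat m n} {g : ℝ → ℝ} {U : Mat m m}
    {s : Fin n → ℝ} {V : Mat n n} (h : ∀ H, L H = derivMap g U s V H) (Z : Mat m n) :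
    frobAdjoint L Z = derivMap g U s V Z := by
  ext i j
  rw [frobAdjoint, Matrix.of_apply, h, frobInner_derivMap, frobInner_single]

/-- Near a matrix without singular value `η`, singular value thresholding is continuously
differentiable, and the adjoint of its derivative is given by `Gam`. -/
theorem exists_isOpen_svt (hmn : n ≤ m) {η : ℝ} (hη : 0 < η) {X₀ : Mat m n}
    (hX₀ : X₀ ∈ noSingValEq m n η) :
    ∃ W : Set (Mat m n), IsOpen W ∧ X₀ ∈ W ∧ (∀ X ∈ W, DifferentiableAt ℝ (svt hmn η) X) ∧
      (∀ H, ContinuousOn (fun X => fderiv ℝ (svt hmn η) X H) W) ∧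
      ∀ X ∈ W, ∀ U s V, IsSVD X U s V → ∀ Z,
        adjointJacobian hmn η Z X = U * Gam hmn η s (Uᵀ * Z * V) * Vᵀ := by
  obtain ⟨δ, R, W, hδ, hδη, hR, hW, hX₀W, hgap⟩ := exists_isOpen_singular_gap hmn hη hX₀
  obtain ⟨g, hg, hgT⟩ := exists_contDiff_softThreshold hη hδ hδη
  have hT : ∀ X ∈ W, ∀ U s V, IsSVD X U s V → ∀ j,
      softThreshold η (s j) = s j * g (s j ^ 2) := fun X hX U s V h j =>
    hgT _ ((neg_lt_zero.2 hη).trans_le (h.nonneg j)) (hgap X hX U s V h j).1.le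
  obtain ⟨h1, h2, h3⟩ := fderiv_spectral (f := svt hmn η) hmn hg hR hW
    (fun X hX U s V h j => (hgap X hX U s V h j).2) (fun X hX U s V h => by
      rw [h.svt_eq hmn hη, rectDiag_map _ (softThreshold_of_le hη.le),
        funext (hT X hX U s V h)])
  refine ⟨W, hW, hX₀W, h1, h2, fun X hX U s V h Z => ?_⟩
  have hd : ∀ j, deriv (softThreshold η) (s j)
      = g (s j ^ 2) + 2 * s j ^ 2 * deriv g (s j ^ 2) := fun j => by
    have hcont : Continuous fun t : ℝ => |t ^ 2 - η ^ 2| := by fun_prop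
    -- The identity holds on a two-sided neighbourhood even if `s j = 0`, because it extends to `t >
    -- -η`; the gap is strict, so it persists near `s j`.
    have hev : softThreshold η =ᶠ[nhds (s j)] fun t => t * g (t ^ 2) := by
      filter_upwards [Ioi_mem_nhds ((neg_lt_zero.2 hη).trans_le (h.nonneg j)),
        (hcont.tendsto (s j)).eventually_const_lt (hgap X hX U s V h j).1] with t ht ht'
      exact hgT t ht (le_of_lt ht')
    have hgd : HasDerivAt g (deriv g (s j ^ 2)) (s j ^ 2) :=
      (hg.differentiable (by simp) _).hasDerivAt
    have hsq : HasDerivAt (fun t => g (t ^ 2)) (deriv g (s j ^ 2) * (2 * s j)) (s j) :=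
      hgd.comp (h₂ := g) (h := fun t => t ^ 2) (s j) (by simpa using hasDerivAt_pow 2 (s j))
    rw [hev.deriv_eq]
    refine HasDerivAt.deriv (((hasDerivAt_id' (s j)).mul hsq).congr_deriv ?_)
    ring
  rw [adjointJacobian, frobAdjoint_eq_derivMap (h3 X hX U s V h),
    Gam_eq_derivCore hmn h.nonneg (hT X hX U s V h) hd]
  rfl

/-! ### Continuity and density. -/

theorem continuousOn_adjointJacobian (hmn : n ≤ m) {η : ℝ} (hη : 0 < η) (Z : Mat m n) :
    ContinuousOn (adjointJacobian hmn η Z) (noSingValEq m n η) := by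
  intro X hX
  obtain ⟨W, hW, hXW, -, hc, -⟩ := exists_isOpen_svt hmn hη hX
  refine ContinuousAt.continuousWithinAt ?_
  refine continuousAt_pi.2 fun i => continuousAt_pi.2 fun j => ?_
  have hZ : Continuous fun B : Mat m n => frobInner Z B :=
    (continuous_const.matrix_mul continuous_id).matrix_trace
  exact hZ.continuousAt.comp ((hc (Matrix.single i j 1)).continuousAt (hW.mem_nhds hXW))

/-- Simple full-rank matrices without singular value `η` are dense. -/
theorem mem_closure_simple (hmn : n ≤ m) {η : ℝ} {X : Mat m n} (hX : X ∈ noSingValEq m n η) :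
    X ∈ closure {Y | Y ∈ noSingValEq m n η ∧ IsSimple Y ∧ IsFullRank Y} := by
  obtain ⟨U, s, V, h⟩ := exists_isSVD hmn X
  -- The slopes `j + 1` are positive and distinct. For `t > 0` all singular values become positive
  -- and equal ones separate, while for small `t` distinct ones remain distinct and `η` is still
  -- avoided.
  let σ : ℝ → Fin n → ℝ := fun t j => s j + t * ((j : ℝ) + 1)
  let γ : ℝ → Mat m n := fun t => U * rectDiag m (σ t) * Vᵀ
  have hrect : Continuous fun t => rectDiag m (σ t) := by
    refine continuous_pi fun i => continuous_pi fun j => ?_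
    simp only [rectDiag, Matrix.of_apply, σ]
    split_ifs <;> fun_prop
  have hγ : Continuous γ :=
    (continuous_const.matrix_mul hrect).matrix_mul continuous_const
  have hγ0 : γ 0 = X := by simp [γ, σ, h.eq_mul]
  have hlim : Filter.Tendsto γ (nhdsWithin 0 (Set.Ioi 0)) (nhds X) := by
    rw [← hγ0]; exact hγ.continuousWithinAt
  refine mem_closure_of_tendsto hlim ?_
  have hpos : ∀ᶠ t : ℝ in nhdsWithin 0 (Set.Ioi 0), 0 < t := self_mem_nhdsWithin
  have hη : ∀ᶠ t : ℝ in nhdsWithin 0 (Set.Ioi 0), ∀ j, σ t j ≠ η := by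
    refine Filter.eventually_all.2 fun j => ?_
    have : Continuous fun t => σ t j := by fun_prop
    refine (this.tendsto 0).mono_left nhdsWithin_le_nhds |>.eventually_ne ?_
    simpa [σ] using (h.mem_noSingValEq_iff hmn η).1 hX j
  have hinj : ∀ᶠ t : ℝ in nhdsWithin 0 (Set.Ioi 0), ∀ i j, σ t i = σ t j → i = j := by
    refine Filter.eventually_all.2 fun i => Filter.eventually_all.2 fun j => ?_
    by_cases hs : s i = s j
    · filter_upwards [hpos] with t ht e
      have : (i : ℝ) = j := by
        have : t * (i + 1) = t * ((j : ℝ) + 1) := by simpa [σ, hs] using e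
        linarith [mul_left_cancel₀ ht.ne' this]
      exact Fin.ext (by exact_mod_cast this)
    · have hc : Continuous fun t => σ t i - σ t j := by fun_prop
      have : ∀ᶠ t : ℝ in nhdsWithin 0 (Set.Ioi 0), σ t i - σ t j ≠ 0 := by
        refine (hc.tendsto 0).mono_left nhdsWithin_le_nhds |>.eventually_ne ?_
        simpa [σ] using sub_ne_zero.2 hs
      filter_upwards [this] with t ht e
      exact absurd (sub_eq_zero.2 e) ht
  filter_upwards [hpos, hη, hinj] with t ht htη hti
  have hσ : ∀ j, 0 < σ t j := fun j => by
    have := h.nonneg j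
    simp only [σ]
    positivity
  have hsvd : IsSVD (γ t) U (σ t) V :=
    ⟨h.left_orthogonal, h.right_orthogonal, fun j => (hσ j).le, rfl⟩
  exact ⟨(hsvd.mem_noSingValEq_iff hmn η).2 htη, (hsvd.isSimple_iff hmn).2 fun i j => hti i j,
    hsvd.isFullRank hmn fun j => (hσ j).ne'⟩

end SVT
end

theorem mainTheorem3 (m n : ℕ) (hmn : n ≤ m) (η : ℝ) (hη : 0 < η) (Z : SVT.Mat m n) :
    -- `F(X) = U 𝒯_η(Σ) Vᵀ` for every singular value decomposition of `X`
    (∀ (X : SVT.Mat m n) (U : SVT.Mat m m) (s : Fin n → ℝ) (V : SVT.Mat n n),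
      SVT.IsSVD X U s V →
        SVT.svt hmn η X =
          U * (SVT.rectDiag m s).map (SVT.softThreshold η) * V.transpose) ∧
    -- `X ↦ (DF(X))^* Z` is defined at simple full-rank matrices without singular value `η`
    (∀ X ∈ SVT.noSingValEq m n η, SVT.IsSimple X → SVT.IsFullRank X →
      DifferentiableAt ℝ (SVT.svt hmn η) X) ∧
    ∃ G : SVT.Mat m n → SVT.Mat m n,
      -- `G` is continuous on the matrices without singular value `η`
      ContinuousOn G (SVT.noSingValEq m n η) ∧
      -- `G` equals `X ↦ (DF(X))^* Z` wherever the latter is defined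
      (∀ X, DifferentiableAt ℝ (SVT.svt hmn η) X →
        G X = SVT.adjointJacobian hmn η Z X) ∧
      -- `G(X) = U Γ Vᵀ`, with `ζ = Uᵀ Z V`, for every singular value decomposition of `X`
      (∀ X ∈ SVT.noSingValEq m n η,
        ∀ (U : SVT.Mat m m) (s : Fin n → ℝ) (V : SVT.Mat n n), SVT.IsSVD X U s V →
          G X = U * SVT.Gam hmn η s (U.transpose * Z * V) * V.transpose) ∧
      -- `G` is the only continuous extension from the simple full-rank matrices
      (∀ H : SVT.Mat m n → SVT.Mat m n,
        ContinuousOn H (SVT.noSingValEq m n η) →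
        (∀ X ∈ SVT.noSingValEq m n η, SVT.IsSimple X → SVT.IsFullRank X →
          H X = SVT.adjointJacobian hmn η Z X) →
        Set.EqOn H G (SVT.noSingValEq m n η)) := by
  -- With the adjoint Jacobian itself as `G`, agreement at points of differentiability is
  -- definitional.
  refine ⟨fun X U s V h => h.svt_eq hmn hη, fun X hX _ _ => ?_, SVT.adjointJacobian hmn η Z,
    SVT.continuousOn_adjointJacobian hmn hη Z, fun _ _ => rfl, fun X hX U s V h => ?_,
    fun H hH hHG X hX => ?_⟩
  · obtain ⟨W, -, hXW, hd, -⟩ := SVT.exists_isOpen_svt hmn hη hX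
    exact hd X hXW
  · obtain ⟨W, -, hXW, -, -, hG⟩ := SVT.exists_isOpen_svt hmn hη hX
    exact hG X hXW U s V h Z
  · have hsub : {Y : SVT.Mat m n | Y ∈ SVT.noSingValEq m n η ∧ SVT.IsSimple Y ∧ SVT.IsFullRank Y}
        ⊆ SVT.noSingValEq m n η := fun Y hY => hY.1
    have hmem := SVT.mem_closure_simple hmn hX
    have := mem_closure_iff_nhdsWithin_neBot.1 hmem
    have h1 := (hH X hX).mono hsub
    have h2 := (SVT.continuousOn_adjointJacobian hmn hη Z X hX).mono hsub
    -- Density makes the filter of neighbourhoods within the simple full-rank matrices non-trivial,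
    -- and `H` and `G` agree along it.
    refine tendsto_nhds_unique h1 (h2.congr' ?_)
    filter_upwards [self_mem_nhdsWithin] with Y hY
    exact (hHG Y hY.1 hY.2.1 hY.2.2).symm
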